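/- Let $K$ be an algebraically closed field of characteristic $0$, let $n\ge 1$, and let $S=K[x_0,\dots,x_n]$ with $x_0<x_1<\dots<x_n$. For a homogeneous ideal $I\subseteq S$, the Hilbert polynomial $p_{S/I}(z)\in\mathbb{Q}[z]$ is the polynomial with $p_{S/I}(t)=\dim_K (S/I)_t$ for all large integers $t$, and $I$ is saturated if every $f\in S$ such that for each $i$ some $x_i^{k_i}f$ lies in $I$ belongs to $I$. A polynomial in $\mathbb{Q}[z]$ is admissible if it is the Hilbert polynomial of a closed subscheme of some projective space $\mathbb{P}^N_K$ (equivalently, of $K[x_0,\dots,x_N]/I$ for some saturated homogeneous ideal $I$). The empty subscheme is allowed, so $0$ is admissible; the zero polynomial is counted among the polynomials of degree $0$. A Borel ideal of $S$ is an ideal $J$ generated by monomials such that, whenever $x^\alpha\in J$ is a monomial and $x^\beta$ is a monomial from which $x^\alpha$ is obtained by finitely many moves, each replacing a factor $x_j$ ($1\le j\le n$) by $x_{j-1}$, also $x^\beta\in J$. The $x_1$-saturation of a Borel ideal $J$ is the ideal generated by the monomials obtained by setting $x_0=x_1=1$ in the minimal monomial generators of $J$; $J$ is $x_1$-saturated if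 it equals its $x_1$-saturation. Let $p(z)$ be an admissible polynomial of degree $h\le n$, and let $$P:=\{\,q(z)=p(z)+u \mid u\in\mathbb{Z},\ q(z)\text{ admissible}\,\}$$ be the set of all admissible polynomials of degree $h$ that differ from $p(z)$ by an integer constant. Then: (i) there is a polynomial $\hat p(z)\in P$ such that every $q(z)\in P$ is of the form $q(z)=\hat p(z)+c$ with an integer $c\ge 0$; (ii) every saturated Borel ideal $I\subseteq S$ with Hilbert polynomial $p_{S/I}(z)=\hat p(z)$ is $x_1$-saturated. -/

import Mathlib

namespace BorelIdeals

/-- Terms (power products) `x^α` of `K[x_0, …, x_n]`, represented by their exponent vectors `α`. -/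
abbrev Term (n : ℕ) : Type := Fin (n + 1) →₀ ℕ

/-- The term `x^α` as a polynomial. -/
noncomputable def Term.toPoly (K : Type*) [Field K] {n : ℕ} (α : Term n) :
    MvPolynomial (Fin (n + 1)) K :=
  MvPolynomial.monomial α 1

/-- The elementary move `e_{j+1}^-` (for `j + 1 ∈ {1, …, n}`): it replaces one factor `x_{j+1}`
of `x^β` by `x_j`.  Only used when `x_{j+1}` divides `x^β`. -/
noncomputable def eMinus {n : ℕ} (j : Fin n) (β : Term n) : Term n :=
  β - Finsupp.single j.succ 1 + Finsupp.single j.castSucc 1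

/-- The Borel partial order `x^α <_B x^β`: the transitive closure of `e_j^-(x^β) < x^β`. -/
def BorelLT {n : ℕ} (α β : Term n) : Prop :=
  Relation.TransGen (fun a b : Term n => ∃ j : Fin n, 0 < b j.succ ∧ a = eMinus j b) α β

/-- A set `B` of terms of degree `t` is a Borel set if it is closed upwards under `<_B`
among the terms of degree `t`. -/
def IsBorelSet {n : ℕ} (t : ℕ) (B : Set (Term n)) : Prop :=
  B ⊆ {α | α.degree = t} ∧
    ∀ α ∈ B, ∀ β : Term n, β.degree = t → BorelLT α β → β ∈ B

/-- A monomial ideal is an ideal generated by terms. -/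
def IsMonomialIdeal {K : Type*} [Field K] {n : ℕ}
    (J : Ideal (MvPolynomial (Fin (n + 1)) K)) : Prop :=
  ∃ A : Set (Term n), J = Ideal.span (Term.toPoly K '' A)

/-- A Borel ideal is a monomial ideal whose terms of each degree form a Borel set. -/
def IsBorelIdeal {K : Type*} [Field K] {n : ℕ}
    (J : Ideal (MvPolynomial (Fin (n + 1)) K)) : Prop :=
  IsMonomialIdeal J ∧
    ∀ t : ℕ, IsBorelSet t {α : Term n | α.degree = t ∧ α.toPoly K ∈ J}

/-- The saturation condition `I = I^sat`, where
`I^sat = {f | ∀ i, ∃ k, x_i^k f ∈ I}` (the inclusion `I ⊆ I^sat` always holds). -/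
def IsSaturated {K : Type*} [Field K] {n : ℕ}
    (I : Ideal (MvPolynomial (Fin (n + 1)) K)) : Prop :=
  ∀ f : MvPolynomial (Fin (n + 1)) K,
    (∀ i : Fin (n + 1), ∃ k : ℕ, MvPolynomial.X i ^ k * f ∈ I) → f ∈ I

/-- The minimal generating set `G(J)` of a monomial ideal `J` consisting of terms: the terms
of `J` that are minimal for divisibility. -/
def minGens {K : Type*} [Field K] {n : ℕ}
    (J : Ideal (MvPolynomial (Fin (n + 1)) K)) : Set (Term n) :=
  {α | Minimal (fun β : Term n => β.toPoly K ∈ J) α}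

/-- The term obtained from `x^α` by setting `x_0 = x_1 = 1`: only the exponents of
`x_2, …, x_n` are kept. -/
def setX0X1One {n : ℕ} (α : Term n) : Term n :=
  α.filter (fun i : Fin (n + 1) => 2 ≤ (i : ℕ))

/-- The `x_1`-saturation `J_{x_0 x_1}`: the ideal generated by the terms obtained by setting
`x_0 = x_1 = 1` in the minimal generators of `J`. -/
noncomputable def x1Saturation {K : Type*} [Field K] {n : ℕ}
    (J : Ideal (MvPolynomial (Fin (n + 1)) K)) : Ideal (MvPolynomial (Fin (n + 1)) K) :=
  Ideal.span (Term.toPoly K '' (setX0X1One '' minGens J))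

/-- `J` is `x_1`-saturated if it equals its `x_1`-saturation. -/
def IsX1Saturated {K : Type*} [Field K] {n : ℕ}
    (J : Ideal (MvPolynomial (Fin (n + 1)) K)) : Prop :=
  J = x1Saturation J

/-- The Hilbert function of `S/I`: the `K`-dimension of the degree `t` part of `S/I`, that is of
the image of the forms of degree `t`. -/
noncomputable def hilbertFunction {K : Type*} [Field K] {n : ℕ}
    (I : Ideal (MvPolynomial (Fin (n + 1)) K)) (t : ℕ) : ℕ :=
  Module.finrank K
    ((MvPolynomial.homogeneousSubmodule (Fin (n + 1)) K t).map
      (Ideal.Quotient.mkₐ K I).toLinearMap)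

/-- `p` is the Hilbert polynomial `p_{S/I}`: it agrees with the Hilbert function of `S/I`
in all large degrees (which determines `p`). -/
def IsHilbertPolynomial {K : Type*} [Field K] {n : ℕ}
    (I : Ideal (MvPolynomial (Fin (n + 1)) K)) (p : Polynomial ℚ) : Prop :=
  ∃ t₀ : ℕ, ∀ t : ℕ, t₀ ≤ t → (hilbertFunction I t : ℚ) = p.eval (t : ℚ)

/-- A homogeneous ideal: it contains every homogeneous component of each of its elements. -/
def IsHomogeneousIdeal {K : Type*} [Field K] {n : ℕ}
    (I : Ideal (MvPolynomial (Fin (n + 1)) K)) : Prop :=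
  ∀ f ∈ I, ∀ t : ℕ, MvPolynomial.homogeneousComponent t f ∈ I

/-- `p` is admissible if it is the Hilbert polynomial of a (possibly empty) closed subscheme of
some projective space `ℙ^N` over `K`.  Closed subschemes of `ℙ^N` are given by the saturated
homogeneous ideals `I` of `K[x_0, …, x_N]`, and their Hilbert polynomial is `p_{S/I}`. -/
def IsAdmissible (K : Type*) [Field K] (p : Polynomial ℚ) : Prop :=
  ∃ (N : ℕ) (I : Ideal (MvPolynomial (Fin (N + 1)) K)),
    IsHomogeneousIdeal I ∧ IsSaturated I ∧ IsHilbertPolynomial I p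

/-- The set of all admissible polynomials of the form `p + u` with `u` an integer. -/
def admissibleTranslates (K : Type*) [Field K] (p : Polynomial ℚ) : Set (Polynomial ℚ) :=
  {q | IsAdmissible K q ∧ ∃ u : ℤ, q = p + Polynomial.C (u : ℚ)}

end BorelIdeals

namespace BorelIdeals

open MvPolynomial

-- Homogeneous components and homogeneous ideals.

attribute [local instance] MvPolynomial.gradedAlgebra

variable {K : Type*} [Field K] {n : ℕ}

/-! Part (i) says that the constants `u` with `p + u` admissible are bounded below. A saturated
ideal `J` has a regular linear form `h`, and the section `J + (h)`, once saturated, has Hilbert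
polynomial `Δq`, the backward difference of that of `J`. Induction on the degree then gives a degree
`d`, depending only on the polynomial and not on the number of variables, from which Hilbert
function and polynomial agree (`exists_isRegularityBound`). If `d` is such a bound for `Δp`, the
increments of the Hilbert function of `J` are at least those of `q` beyond `d`, so `0 ≤ H_J(d) ≤
q(d)`. All translates of `p` share `Δp`, hence `d`, and `0 ≤ p(d) + u` bounds `u`.

For (ii), let `J = I : x_1^∞`. By the Borel property `I + (x_0)` and `J + (x_0)` agree in large
degrees, and `x_0` is regular modulo both ideals, so the Hilbert polynomial of `J` is `p̂ - c` with
`c ≥ 0`. Since `J` is saturated and homogeneous, minimality of `p̂` forces `c = 0`, hence `I = J`.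
Powers of `x_0` and `x_1` can then be cancelled from the generators of `I`. -/

lemma coe_decompose_eq_homogeneousComponent (f : MvPolynomial (Fin (n + 1)) K) (t : ℕ) :
    (DirectSum.decompose (homogeneousSubmodule (Fin (n + 1)) K) f t :
      MvPolynomial (Fin (n + 1)) K) = homogeneousComponent t f :=
  decomposition.decompose'_apply f t

lemma homogeneousComponent_mul_left {h : MvPolynomial (Fin (n + 1)) K} {i : ℕ}
    (hh : h.IsHomogeneous i) (b : MvPolynomial (Fin (n + 1)) K) (t : ℕ) :
    homogeneousComponent (t + i) (h * b) = h * homogeneousComponent t b := by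
  have := DirectSum.coe_decompose_mul_of_left_mem_of_le
    (homogeneousSubmodule (Fin (n + 1)) K) (a := h) (b := b) (n := t + i) (i := i) hh (by omega)
  rwa [Nat.add_sub_cancel, coe_decompose_eq_homogeneousComponent,
    coe_decompose_eq_homogeneousComponent] at this

lemma isHomogeneousIdeal_iff {I : Ideal (MvPolynomial (Fin (n + 1)) K)} :
    IsHomogeneousIdeal I ↔ I.IsHomogeneous (homogeneousSubmodule (Fin (n + 1)) K) :=
  ⟨fun h i _ hr => by
    rw [coe_decompose_eq_homogeneousComponent]
    exact h _ hr i, fun h _ hf t => homogeneousComponent_mem_of_mem h hf t⟩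

lemma isHomogeneousIdeal_span {s : Set (MvPolynomial (Fin (n + 1)) K)}
    (hs : ∀ x ∈ s, ∃ i, x.IsHomogeneous i) : IsHomogeneousIdeal (Ideal.span s) :=
  isHomogeneousIdeal_iff.2 (Ideal.homogeneous_span _ _ hs)

lemma IsHomogeneousIdeal.sup {I J : Ideal (MvPolynomial (Fin (n + 1)) K)}
    (hI : IsHomogeneousIdeal I) (hJ : IsHomogeneousIdeal J) : IsHomogeneousIdeal (I ⊔ J) :=
  isHomogeneousIdeal_iff.2
    ((isHomogeneousIdeal_iff.1 hI).sup (isHomogeneousIdeal_iff.1 hJ))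

lemma mem_of_homogeneousComponent_mem {I : Ideal (MvPolynomial (Fin (n + 1)) K)}
    {f : MvPolynomial (Fin (n + 1)) K} (h : ∀ t, homogeneousComponent t f ∈ I) : f ∈ I := by
  rw [← sum_homogeneousComponent f]
  exact Ideal.sum_mem _ fun t _ => h t

/-! ### Saturation. -/

/-- The saturation of `I` with respect to the irrelevant ideal. -/
def saturation (I : Ideal (MvPolynomial (Fin (n + 1)) K)) :
    Ideal (MvPolynomial (Fin (n + 1)) K) where
  carrier := {f | ∀ i, ∃ k : ℕ, X i ^ k * f ∈ I}
  add_mem' := by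
    intro f g hf hg i
    obtain ⟨k, hk⟩ := hf i
    obtain ⟨l, hl⟩ := hg i
    refine ⟨k + l, ?_⟩
    have : X i ^ (k + l) * (f + g) = X i ^ l * (X i ^ k * f) + X i ^ k * (X i ^ l * g) := by ring
    rw [this]
    exact I.add_mem (I.mul_mem_left _ hk) (I.mul_mem_left _ hl)
  zero_mem' := fun i => ⟨0, by simp⟩
  smul_mem' := by
    intro c f hf i
    obtain ⟨k, hk⟩ := hf i
    refine ⟨k, ?_⟩
    rw [smul_eq_mul, mul_left_comm]
    exact I.mul_mem_left _ hk

lemma le_saturation (I : Ideal (MvPolynomial (Fin (n + 1)) K)) : I ≤ saturation I :=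
  fun f hf _ => ⟨0, by simpa using hf⟩

lemma isSaturated_saturation (I : Ideal (MvPolynomial (Fin (n + 1)) K)) :
    IsSaturated (saturation I) := by
  intro f hf i
  obtain ⟨k, hk⟩ := hf i
  obtain ⟨l, hl⟩ := hk i
  exact ⟨l + k, by rwa [pow_add, mul_assoc]⟩

lemma X_pow_mul_homogeneousComponent_mem {I : Ideal (MvPolynomial (Fin (n + 1)) K)}
    (hI : IsHomogeneousIdeal I) {f : MvPolynomial (Fin (n + 1)) K} {i : Fin (n + 1)} {k : ℕ}
    (h : X i ^ k * f ∈ I) (t : ℕ) : X i ^ k * homogeneousComponent t f ∈ I := by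
  rw [← homogeneousComponent_mul_left (isHomogeneous_X_pow i k)]
  exact hI _ h _

lemma IsHomogeneousIdeal.saturation {I : Ideal (MvPolynomial (Fin (n + 1)) K)}
    (hI : IsHomogeneousIdeal I) : IsHomogeneousIdeal (saturation I) := by
  intro f hf t i
  obtain ⟨k, hk⟩ := hf i
  exact ⟨k, X_pow_mul_homogeneousComponent_mem hI hk t⟩

/-- A homogeneous ideal agrees with its saturation in all large degrees. -/
lemma exists_mem_of_mem_saturation {I : Ideal (MvPolynomial (Fin (n + 1)) K)}
    (hI : IsHomogeneousIdeal I) :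
    ∃ T : ℕ, ∀ t, T ≤ t → ∀ f ∈ saturation I, f.IsHomogeneous t → f ∈ I := by
  classical
  obtain ⟨G, hG⟩ := (isNoetherianRing_iff_ideal_fg _).1
    (inferInstance : IsNoetherianRing (MvPolynomial (Fin (n + 1)) K)) (saturation I)
  have hGs : ∀ g ∈ G, g ∈ saturation I := fun g hg => hG ▸ Submodule.subset_span hg
  have hk : ∀ g : MvPolynomial (Fin (n + 1)) K, ∃ k : ℕ, g ∈ G → ∀ i, X i ^ k * g ∈ I := by
    intro g
    by_cases hg : g ∈ G
    · choose k hk using hGs g hg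
      refine ⟨Finset.univ.sup k, fun _ i => ?_⟩
      have hle : k i ≤ Finset.univ.sup k := Finset.le_sup (Finset.mem_univ i)
      rw [← Nat.sub_add_cancel hle, pow_add, mul_assoc]
      exact I.mul_mem_left _ (hk i)
    · exact ⟨0, fun h => absurd h hg⟩
  choose k hk using hk
  -- A monomial with all exponents below `k g` has degree at most `(n + 1) * k g`. Beyond this bound
  -- a coefficient monomial either is divisible by some `x_i ^ k g`, which sends `g` into `I`, or
  -- has a product with `g` of degree less than `t`.
  refine ⟨G.sup fun g => (n + 1) * k g + g.totalDegree + 1, fun t ht f hf hft => ?_⟩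
  rw [← hG] at hf
  obtain ⟨c, -, rfl⟩ := Submodule.mem_span_finset.1 hf
  rw [← homogeneousComponent_eq_self hft, map_sum]
  refine Ideal.sum_mem _ fun g hg => ?_
  have ht' : (n + 1) * k g + g.totalDegree + 1 ≤ t :=
    (Finset.le_sup (f := fun g => (n + 1) * k g + g.totalDegree + 1) hg).trans ht
  rw [smul_eq_mul]
  induction c g using MvPolynomial.induction_on' with
  | monomial α a =>
    by_cases hα : ∃ i, k g ≤ α i
    · obtain ⟨i, hi⟩ := hα
      refine hI _ ?_ t
      have : monomial α a = monomial (α - Finsupp.single i (k g)) a * X i ^ k g := by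
        rw [X_pow_eq_monomial, monomial_mul, mul_one, tsub_add_cancel_of_le]
        simpa using hi
      rw [this, mul_assoc]
      exact I.mul_mem_left _ (hk g hg i)
    · push Not at hα
      have hdeg : α.degree ≤ (n + 1) * k g := by
        rw [Finsupp.degree_eq_sum]
        calc ∑ i, α i ≤ ∑ _i : Fin (n + 1), k g := Finset.sum_le_sum fun i _ => (hα i).le
          _ = _ := by simp
      rw [homogeneousComponent_eq_zero]
      · exact I.zero_mem
      · refine (totalDegree_mul _ _).trans_lt ?_
        have : (monomial α a).totalDegree ≤ α.degree :=
          (isHomogeneous_monomial a rfl).totalDegree_le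
        omega
  | add p q hp hq =>
    rw [add_mul, map_add]
    exact I.add_mem hp hq

/-! ### Graded parts and Hilbert functions. -/

/-- The degree `t` part of an ideal. -/
noncomputable def gradedPart (I : Ideal (MvPolynomial (Fin (n + 1)) K)) (t : ℕ) :
    Submodule K (MvPolynomial (Fin (n + 1)) K) :=
  I.restrictScalars K ⊓ homogeneousSubmodule (Fin (n + 1)) K t

lemma mem_gradedPart {I : Ideal (MvPolynomial (Fin (n + 1)) K)} {t : ℕ}
    {f : MvPolynomial (Fin (n + 1)) K} :
    f ∈ gradedPart I t ↔ f ∈ I ∧ f.IsHomogeneous t := Iff.rfl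

instance (t : ℕ) : FiniteDimensional K (homogeneousSubmodule (Fin (n + 1)) K t) :=
  Module.Finite.iff_fg.2 (homogeneousSubmodule_fg _ K t)

instance (I : Ideal (MvPolynomial (Fin (n + 1)) K)) (t : ℕ) :
    FiniteDimensional K (gradedPart I t) :=
  Submodule.finiteDimensional_inf_right _ _

lemma hilbertFunction_add_finrank_gradedPart (I : Ideal (MvPolynomial (Fin (n + 1)) K)) (t : ℕ) :
    hilbertFunction I t + Module.finrank K (gradedPart I t) =
      Module.finrank K (homogeneousSubmodule (Fin (n + 1)) K t) := by
  have h := LinearMap.finrank_range_add_finrank_ker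
    ((Ideal.Quotient.mkₐ K I).toLinearMap.domRestrict (homogeneousSubmodule (Fin (n + 1)) K t))
  rw [LinearMap.range_domRestrict, LinearMap.ker_domRestrict,
    ← Submodule.finrank_map_subtype_eq, Submodule.map_comap_subtype] at h
  have hker : (Ideal.Quotient.mkₐ K I).toLinearMap.ker = I.restrictScalars K := by
    ext f
    simp [Ideal.Quotient.eq_zero_iff_mem]
  rw [← h, hilbertFunction, gradedPart, inf_comm, hker]

lemma gradedPart_mono {I J : Ideal (MvPolynomial (Fin (n + 1)) K)} (h : I ≤ J) (t : ℕ) :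
    gradedPart I t ≤ gradedPart J t :=
  inf_le_inf_right _ h

lemma hilbertFunction_anti {I J : Ideal (MvPolynomial (Fin (n + 1)) K)} (h : I ≤ J) (t : ℕ) :
    hilbertFunction J t ≤ hilbertFunction I t := by
  have h1 := hilbertFunction_add_finrank_gradedPart I t
  have h2 := hilbertFunction_add_finrank_gradedPart J t
  have h3 := Submodule.finrank_mono (gradedPart_mono h t)
  omega

lemma hilbertFunction_congr {I J : Ideal (MvPolynomial (Fin (n + 1)) K)} {t : ℕ}
    (h : gradedPart I t = gradedPart J t) : hilbertFunction I t = hilbertFunction J t := by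
  have h1 := hilbertFunction_add_finrank_gradedPart I t
  have h2 := hilbertFunction_add_finrank_gradedPart J t
  rw [h] at h1
  omega

lemma gradedPart_eq_of_hilbertFunction_eq {I J : Ideal (MvPolynomial (Fin (n + 1)) K)}
    (h : I ≤ J) {t : ℕ} (ht : hilbertFunction I t = hilbertFunction J t) :
    gradedPart I t = gradedPart J t := by
  have h1 := hilbertFunction_add_finrank_gradedPart I t
  have h2 := hilbertFunction_add_finrank_gradedPart J t
  exact Submodule.eq_of_le_of_finrank_eq (gradedPart_mono h t) (by omega)

lemma gradedPart_saturation_eventually_eq {I : Ideal (MvPolynomial (Fin (n + 1)) K)}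
    (hI : IsHomogeneousIdeal I) :
    ∃ T : ℕ, ∀ t, T ≤ t → gradedPart I t = gradedPart (saturation I) t := by
  obtain ⟨T, hT⟩ := exists_mem_of_mem_saturation hI
  exact ⟨T, fun t ht => le_antisymm (gradedPart_mono (le_saturation I) t)
    fun f hf => ⟨hT t ht f hf.1 hf.2, hf.2⟩⟩

lemma exists_add_mul_of_mem_sup_span {I : Ideal (MvPolynomial (Fin (n + 1)) K)}
    {h f : MvPolynomial (Fin (n + 1)) K} (hf : f ∈ I ⊔ Ideal.span {h}) :
    ∃ a ∈ I, ∃ b, f = a + h * b := by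
  obtain ⟨a, ha, c, hc, rfl⟩ := Submodule.mem_sup.1 hf
  obtain ⟨b, rfl⟩ := Ideal.mem_span_singleton'.1 hc
  exact ⟨a, ha, b, by rw [mul_comm]⟩

lemma gradedPart_sup_span_succ {I : Ideal (MvPolynomial (Fin (n + 1)) K)}
    (hI : IsHomogeneousIdeal I) {h : MvPolynomial (Fin (n + 1)) K} (hh : h.IsHomogeneous 1)
    (t : ℕ) : gradedPart (I ⊔ Ideal.span {h}) (t + 1) =
      gradedPart I (t + 1) ⊔
        (homogeneousSubmodule (Fin (n + 1)) K t).map (LinearMap.mulLeft K h) := by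
  refine le_antisymm (fun f hf => ?_) (sup_le (gradedPart_mono le_sup_left _) ?_)
  · obtain ⟨a, ha, b, hab⟩ := exists_add_mul_of_mem_sup_span hf.1
    have : f = homogeneousComponent (t + 1) a + h * homogeneousComponent t b := by
      rw [← homogeneousComponent_mul_left hh, ← map_add, ← hab, homogeneousComponent_eq_self hf.2]
    rw [this]
    exact Submodule.add_mem_sup ⟨hI a ha _, homogeneousComponent_isHomogeneous _ _⟩
      ⟨_, homogeneousComponent_isHomogeneous _ _, rfl⟩
  · rintro _ ⟨b, hb, rfl⟩
    refine ⟨Ideal.mem_sup_right (Ideal.mul_mem_right _ _ (Ideal.mem_span_singleton_self h)), ?_⟩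
    have := hh.mul (show b.IsHomogeneous t from hb)
    rw [add_comm 1 t] at this
    exact this

/-- The effect of a hyperplane section on the Hilbert function. -/
lemma hilbertFunction_sup_span_succ {I : Ideal (MvPolynomial (Fin (n + 1)) K)}
    (hI : IsHomogeneousIdeal I) {h : MvPolynomial (Fin (n + 1)) K} (hh : h.IsHomogeneous 1)
    (h0 : h ≠ 0) (hreg : ∀ f, h * f ∈ I → f ∈ I) (t : ℕ) :
    hilbertFunction (I ⊔ Ideal.span {h}) (t + 1) + hilbertFunction I t =
      hilbertFunction I (t + 1) := by
  have hinj : Function.Injective (LinearMap.mulLeft K h) := fun a b hab =>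
    mul_left_cancel₀ h0 hab
  have hmap : ∀ V : Submodule K (MvPolynomial (Fin (n + 1)) K),
      Module.finrank K (V.map (LinearMap.mulLeft K h)) = Module.finrank K V := fun V =>
    (Submodule.equivMapOfInjective _ hinj V).finrank_eq.symm
  have hinf : gradedPart I (t + 1) ⊓
      (homogeneousSubmodule (Fin (n + 1)) K t).map (LinearMap.mulLeft K h) =
      (gradedPart I t).map (LinearMap.mulLeft K h) := by
    ext f
    constructor
    · rintro ⟨hf, b, hb, rfl⟩
      exact ⟨b, ⟨hreg b hf.1, hb⟩, rfl⟩
    · rintro ⟨b, hb, rfl⟩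
      refine ⟨⟨I.mul_mem_left _ hb.1, ?_⟩, b, hb.2, rfl⟩
      have := hh.mul (show b.IsHomogeneous t from hb.2)
      rw [add_comm 1 t] at this
      exact this
  have hsum := Submodule.finrank_sup_add_finrank_inf_eq (gradedPart I (t + 1))
    ((homogeneousSubmodule (Fin (n + 1)) K t).map (LinearMap.mulLeft K h))
  rw [hinf, hmap, hmap, ← gradedPart_sup_span_succ hI hh] at hsum
  have h1 := hilbertFunction_add_finrank_gradedPart (I ⊔ Ideal.span {h}) (t + 1)
  have h2 := hilbertFunction_add_finrank_gradedPart I (t + 1)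
  have h3 := hilbertFunction_add_finrank_gradedPart I t
  omega

/-- Two nested saturated ideals with the same Hilbert function in large degrees are equal. -/
lemma eq_of_hilbertFunction_eventually_eq {I J : Ideal (MvPolynomial (Fin (n + 1)) K)}
    (hIs : IsSaturated I) (hJ : IsHomogeneousIdeal J) (h : I ≤ J) {T : ℕ}
    (hT : ∀ t, T ≤ t → hilbertFunction I t = hilbertFunction J t) : I = J := by
  -- Multiplying by `x_i ^ T` moves every component into the degrees where the graded parts
  -- coincide.
  refine le_antisymm h fun f hf => mem_of_homogeneousComponent_mem fun t => hIs _ fun i => ⟨T, ?_⟩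
  have hmem : X i ^ T * homogeneousComponent t f ∈ gradedPart J (T + t) :=
    ⟨J.mul_mem_left _ (hJ f hf t),
      (isHomogeneous_X_pow i T).mul (homogeneousComponent_isHomogeneous t f)⟩
  rw [← gradedPart_eq_of_hilbertFunction_eq h (hT (T + t) (Nat.le_add_right _ _))] at hmem
  exact hmem.1

/-! ### Hyperplane sections and backward differences. -/

/-- Over an infinite field, a saturated ideal has a linear form regular modulo it. -/
lemma exists_linear_regular [Infinite K] {J : Ideal (MvPolynomial (Fin (n + 1)) K)}
    (hJ : IsSaturated J) :
    ∃ h : MvPolynomial (Fin (n + 1)) K, h.IsHomogeneous 1 ∧ h ≠ 0 ∧ ∀ f, h * f ∈ J → f ∈ J := by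
  classical
  by_cases htop : J = ⊤
  · exact ⟨X 0, isHomogeneous_X K 0, X_ne_zero 0, fun f _ => htop ▸ Submodule.mem_top⟩
  let R := MvPolynomial (Fin (n + 1)) K
  have hfin := associatedPrimes.finite R (R ⧸ J)
  let V := homogeneousSubmodule (Fin (n + 1)) K 1
  let s : Finset (Subspace K V) :=
    hfin.toFinset.image fun P => (P.restrictScalars K).comap V.subtype
  -- An associated prime containing all linear forms would be the annihilator of a class `f` killed
  -- by every `x_i`; saturation makes that class zero.
  have hs : ⊤ ∉ s := by
    intro hmem
    obtain ⟨P, hP, hPtop⟩ := Finset.mem_image.1 hmem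
    rw [Set.Finite.mem_toFinset, AssociatedPrimes.mem_iff, isAssociatedPrime_iff] at hP
    obtain ⟨hprime, x, hx⟩ := hP
    obtain ⟨f, rfl⟩ := Ideal.Quotient.mk_surjective x
    have hX : ∀ i, X i * f ∈ J := by
      intro i
      have : (⟨X i, isHomogeneous_X K i⟩ : V) ∈ (P.restrictScalars K).comap V.subtype :=
        hPtop ▸ Submodule.mem_top
      have hXP : X i ∈ P := this
      rw [hx, Submodule.mem_colon_singleton, Submodule.mem_bot] at hXP
      rw [← Ideal.Quotient.eq_zero_iff_mem, ← hXP]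
      rfl
    have hf : f ∈ J := hJ f fun i => ⟨1, by simpa using hX i⟩
    apply hprime.ne_top
    rw [hx, Ideal.eq_top_iff_one, Submodule.mem_colon_singleton,
      Ideal.Quotient.eq_zero_iff_mem.2 hf]
    simp
  -- A vector space over an infinite field is not a finite union of proper subspaces.
  have hne := Subspace.biUnion_ne_univ_of_top_notMem hs
  obtain ⟨⟨h, hh⟩, hnot⟩ := (Set.ne_univ_iff_exists_notMem _).1 hne
  have hreg : ∀ f, h * f ∈ J → f ∈ J := by
    intro f hf
    by_contra hfJ
    apply hnot
    have hz : h ∈ {r : R | ∃ x : R ⧸ J, x ≠ 0 ∧ r • x = 0} :=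
      ⟨Ideal.Quotient.mk J f, fun h0 => hfJ (Ideal.Quotient.eq_zero_iff_mem.1 h0),
        Ideal.Quotient.eq_zero_iff_mem.2 hf⟩
    rw [← biUnion_associatedPrimes_eq_zero_divisors] at hz
    obtain ⟨P, hP, hhP⟩ := Set.mem_iUnion₂.1 hz
    exact Set.mem_iUnion₂.2 ⟨_, Finset.mem_image_of_mem _ (hfin.mem_toFinset.2 hP), hhP⟩
  refine ⟨h, hh, ?_, hreg⟩
  rintro rfl
  exact htop ((Ideal.eq_top_iff_one J).2 (hreg 1 (by simp)))

/-- The backward difference `q(z) - q(z - 1)`. -/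
noncomputable def backwardDiff (q : Polynomial ℚ) : Polynomial ℚ :=
  q - q.comp (Polynomial.X - Polynomial.C 1)

lemma eval_backwardDiff_succ (q : Polynomial ℚ) (t : ℕ) :
    (backwardDiff q).eval ((t + 1 : ℕ) : ℚ) = q.eval ((t + 1 : ℕ) : ℚ) - q.eval (t : ℚ) := by
  simp [backwardDiff]

lemma degree_backwardDiff_lt {q : Polynomial ℚ} (hq : q ≠ 0) :
    (backwardDiff q).degree < q.degree := by
  have htaylor : q.comp (Polynomial.X - Polynomial.C 1) = Polynomial.taylor (-1) q := by
    simp [Polynomial.taylor_apply, sub_eq_add_neg]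
  rw [backwardDiff, htaylor]
  exact Polynomial.degree_sub_lt_left (by rw [Polynomial.degree_taylor]) hq
    (by rw [Polynomial.leadingCoeff_taylor])

/-- This is why a single regularity bound serves all translates of `p` at once. -/
lemma backwardDiff_add_C (q : Polynomial ℚ) (u : ℚ) :
    backwardDiff (q + Polynomial.C u) = backwardDiff q := by
  simp [backwardDiff]

/-- Applied to the difference of Hilbert function and Hilbert polynomial, in either sign, to carry
their eventual equality down to degree `d`. -/
lemma nonneg_of_antitone_of_eventually_eq_zero {F : ℕ → ℚ} {d T : ℕ}
    (hF : ∀ t, d ≤ t → F (t + 1) ≤ F t) (hT : ∀ t, T ≤ t → F t = 0) {t : ℕ} (ht : d ≤ t) :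
    0 ≤ F t := by
  have h : ∀ m, F (t + m) ≤ F t := by
    intro m
    induction m with
    | zero => rfl
    | succ m ih => exact (hF (t + m) (by omega)).trans ih
  have := h T
  rwa [hT (t + T) (by omega)] at this

lemma isHomogeneousIdeal_hyperplane {J : Ideal (MvPolynomial (Fin (n + 1)) K)}
    (hJ : IsHomogeneousIdeal J) {h : MvPolynomial (Fin (n + 1)) K} (hh : h.IsHomogeneous 1) :
    IsHomogeneousIdeal (J ⊔ Ideal.span {h}) :=
  hJ.sup (isHomogeneousIdeal_span fun x hx => ⟨1, by rwa [Set.mem_singleton_iff.1 hx]⟩)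

/-- Regularity of `h` makes the Hilbert function of the section the difference of that of `J`, and
saturating changes only finitely many degrees. -/
lemma isHilbertPolynomial_hyperplane_saturation {J : Ideal (MvPolynomial (Fin (n + 1)) K)}
    (hJ : IsHomogeneousIdeal J) {q : Polynomial ℚ} (hq : IsHilbertPolynomial J q)
    {h : MvPolynomial (Fin (n + 1)) K} (hh : h.IsHomogeneous 1) (h0 : h ≠ 0)
    (hreg : ∀ f, h * f ∈ J → f ∈ J) :
    IsHilbertPolynomial (saturation (J ⊔ Ideal.span {h})) (backwardDiff q) := by
  obtain ⟨t₀, ht₀⟩ := hq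
  obtain ⟨T, hT⟩ := gradedPart_saturation_eventually_eq (isHomogeneousIdeal_hyperplane hJ hh)
  refine ⟨t₀ + T + 1, fun t ht => ?_⟩
  obtain ⟨s, rfl⟩ : ∃ s, t = s + 1 := ⟨t - 1, by omega⟩
  rw [← hilbertFunction_congr (hT _ (by omega)), eval_backwardDiff_succ, ← ht₀ _ (by omega),
    ← ht₀ _ (by omega), ← hilbertFunction_sup_span_succ hJ hh h0 hreg]
  push_cast
  ring

/-! ### Uniform regularity, by induction on the degree. -/

/-- From degree `d` on, saturated homogeneous ideals with Hilbert polynomial `q` attain their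
Hilbert polynomial and need no further generators, in any number of variables. -/
def IsRegularityBound (K : Type*) [Field K] (q : Polynomial ℚ) (d : ℕ) : Prop :=
  ∀ (N : ℕ) (J : Ideal (MvPolynomial (Fin (N + 1)) K)),
    IsHomogeneousIdeal J → IsSaturated J → IsHilbertPolynomial J q →
      (∀ t, d ≤ t → (hilbertFunction J t : ℚ) = q.eval (t : ℚ)) ∧
      ∀ t, d ≤ t → ∀ f ∈ gradedPart J (t + 1),
        f ∈ Ideal.span (gradedPart J t : Set (MvPolynomial (Fin (N + 1)) K))

/-- The Hilbert function vanishes in some degree `t₀`, so every `x_i ^ t₀` lies in `J` and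
saturation gives `1 ∈ J`. -/
lemma isRegularityBound_zero : IsRegularityBound K 0 0 := by
  intro N J hJ hs hq
  obtain rfl : J = ⊤ := by
    obtain ⟨t₀, ht₀⟩ := hq
    rw [Ideal.eq_top_iff_one]
    refine hs 1 fun i => ⟨t₀, ?_⟩
    have h0 : hilbertFunction J t₀ = 0 := by simpa using ht₀ t₀ le_rfl
    have h1 : hilbertFunction (⊤ : Ideal (MvPolynomial (Fin (N + 1)) K)) t₀ = 0 :=
      Nat.le_zero.1 (h0 ▸ hilbertFunction_anti le_top t₀)
    have h2 := gradedPart_eq_of_hilbertFunction_eq (I := J) le_top (h0.trans h1.symm)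
    have h3 : (X i ^ t₀ : MvPolynomial (Fin (N + 1)) K) ∈ gradedPart ⊤ t₀ :=
      ⟨Submodule.mem_top, isHomogeneous_X_pow i t₀⟩
    rw [← h2] at h3
    simpa using h3.1
  refine ⟨fun t _ => ?_, fun t _ f hf => ?_⟩
  · have h := hilbertFunction_add_finrank_gradedPart
      (⊤ : Ideal (MvPolynomial (Fin (N + 1)) K)) t
    have h' : gradedPart (⊤ : Ideal (MvPolynomial (Fin (N + 1)) K)) t =
        homogeneousSubmodule _ K t := by
      ext f
      simp [mem_gradedPart]
    rw [h'] at h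
    have : hilbertFunction (⊤ : Ideal (MvPolynomial (Fin (N + 1)) K)) t = 0 := by omega
    simp [this]
  · have hdvd : ∀ α : Fin (N + 1) →₀ ℕ, α.degree = t + 1 → monomial α (1 : K) ∈
        Ideal.span (gradedPart (⊤ : Ideal (MvPolynomial (Fin (N + 1)) K)) t :
          Set (MvPolynomial (Fin (N + 1)) K)) := by
      intro α hα
      obtain ⟨i, hi⟩ : ∃ i, α i ≠ 0 := by
        by_contra! hcon
        have : α = 0 := Finsupp.ext hcon
        simp [this] at hα
      have hle : Finsupp.single i 1 ≤ α := by simpa using Nat.one_le_iff_ne_zero.2 hi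
      have hadd := tsub_add_cancel_of_le hle
      have hmul : monomial α (1 : K) = X i * monomial (α - Finsupp.single i 1) 1 := by
        rw [X, monomial_mul, mul_one, add_tsub_cancel_of_le hle]
      rw [hmul]
      refine Ideal.mul_mem_left _ _ (Ideal.subset_span ⟨Submodule.mem_top, ?_⟩)
      refine isHomogeneous_monomial _ ?_
      have := congrArg Finsupp.degree hadd
      rw [map_add, Finsupp.degree_single] at this
      omega
    rw [← support_sum_monomial_coeff f]
    refine Ideal.sum_mem _ fun α hα => ?_
    have : monomial α (coeff α f) = C (coeff α f) * monomial α 1 := by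
      rw [C_mul_monomial, mul_one]
    rw [this]
    exact Ideal.mul_mem_left _ _
      (hdvd α (hf.2.degree_eq_sum_deg_support hα ▸ rfl))

/-- Bounding Hilbert functions from above by the Hilbert polynomial. -/
lemma hilbertFunction_le_of_isRegularityBound {q : Polynomial ℚ} {d : ℕ}
    (hd : IsRegularityBound K (backwardDiff q) d) [Infinite K]
    {J : Ideal (MvPolynomial (Fin (n + 1)) K)} (hJ : IsHomogeneousIdeal J) (hs : IsSaturated J)
    (hq : IsHilbertPolynomial J q) {t : ℕ} (ht : d ≤ t) :
    (hilbertFunction J t : ℚ) ≤ q.eval (t : ℚ) := by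
  obtain ⟨h, hh, h0, hreg⟩ := exists_linear_regular hs
  have hQ := isHilbertPolynomial_hyperplane_saturation hJ hq hh h0 hreg
  have hd' := (hd n _ (isHomogeneousIdeal_hyperplane hJ hh).saturation
    (isSaturated_saturation _) hQ).1
  obtain ⟨T, hT⟩ := hq
  -- The section has at least the Hilbert function of its saturation, which is `Δq` from `d` on; so
  -- `q - H_J` cannot increase.
  refine sub_nonneg.1 (nonneg_of_antitone_of_eventually_eq_zero
    (F := fun t => q.eval (t : ℚ) - hilbertFunction J t) (d := d) (T := T) ?_ ?_ ht)
  · intro s hs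
    have h1 := hd' (s + 1) (by omega)
    rw [eval_backwardDiff_succ] at h1
    have h2 : (hilbertFunction (saturation (J ⊔ Ideal.span {h})) (s + 1) : ℚ) ≤
        hilbertFunction (J ⊔ Ideal.span {h}) (s + 1) :=
      Nat.cast_le.2 (hilbertFunction_anti (le_saturation _) _)
    have h3 : (hilbertFunction (J ⊔ Ideal.span {h}) (s + 1) : ℚ) + hilbertFunction J s =
        hilbertFunction J (s + 1) := by
      exact_mod_cast hilbertFunction_sup_span_succ hJ hh h0 hreg s
    linarith
  · intro s hs
    rw [hT s hs, sub_self]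

/-- Modulo `h`, `f` comes from degree `t` of `J`: `f = g + h * w`. Regularity puts `w` in `J`, and
its degree `t` component again lies in degree `t` of `J`. -/
lemma mem_span_gradedPart_of_hyperplane {J : Ideal (MvPolynomial (Fin (n + 1)) K)}
    (hJ : IsHomogeneousIdeal J) {h : MvPolynomial (Fin (n + 1)) K} (hh : h.IsHomogeneous 1)
    (hreg : ∀ f, h * f ∈ J → f ∈ J) {t : ℕ} {f : MvPolynomial (Fin (n + 1)) K}
    (hf : f ∈ gradedPart J (t + 1))
    (hspan : f ∈ Ideal.span
      (gradedPart (J ⊔ Ideal.span {h}) t : Set (MvPolynomial (Fin (n + 1)) K))) :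
    f ∈ Ideal.span (gradedPart J t : Set (MvPolynomial (Fin (n + 1)) K)) := by
  set L := Ideal.span (gradedPart J t : Set (MvPolynomial (Fin (n + 1)) K)) with hL
  have hLhom : IsHomogeneousIdeal L := isHomogeneousIdeal_span fun x hx => ⟨t, hx.2⟩
  have hLJ : L ≤ J := Ideal.span_le.2 fun x hx => hx.1
  have hle : Ideal.span (gradedPart (J ⊔ Ideal.span {h}) t :
      Set (MvPolynomial (Fin (n + 1)) K)) ≤ L ⊔ Ideal.span {h} := by
    refine Ideal.span_le.2 fun x hx => ?_
    obtain ⟨a, ha, b, hab⟩ := exists_add_mul_of_mem_sup_span hx.1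
    rw [SetLike.mem_coe, ← homogeneousComponent_eq_self hx.2, hab, map_add]
    refine Ideal.add_mem _ (Ideal.mem_sup_left (Ideal.subset_span
      ⟨hJ a ha t, homogeneousComponent_isHomogeneous _ _⟩)) (Ideal.mem_sup_right ?_)
    exact isHomogeneousIdeal_span (s := {h})
      (fun x hx => ⟨1, by rwa [Set.mem_singleton_iff.1 hx]⟩) _
      (Ideal.mul_mem_right _ _ (Ideal.mem_span_singleton_self h)) t
  obtain ⟨g, hg, w, hgw⟩ := exists_add_mul_of_mem_sup_span (hle hspan)
  have hw : w ∈ J := hreg w (by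
    have : h * w = f - g := by rw [hgw]; ring
    rw [this]
    exact J.sub_mem hf.1 (hLJ hg))
  rw [← homogeneousComponent_eq_self hf.2, hgw, map_add, homogeneousComponent_mul_left hh]
  exact L.add_mem (hLhom g hg _) (L.mul_mem_left _ (Ideal.subset_span
    ⟨hJ w hw t, homogeneousComponent_isHomogeneous _ _⟩))

lemma exists_isRegularityBound_of_backwardDiff [Infinite K] {q : Polynomial ℚ} {d : ℕ}
    (hd : IsRegularityBound K (backwardDiff q) d) : ∃ d', IsRegularityBound K q d' := by
  -- The defect `q - H_J` is nonnegative from `d` on and at most `q(d)` at `d`. It drops by at least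
  -- one per degree as long as the section differs from its saturation, so this can last at most
  -- `⌊q(d)⌋` steps.
  refine ⟨d + (⌊q.eval (d : ℚ)⌋₊ + 1), fun N J hJ hs hq => ?_⟩
  set m₀ := ⌊q.eval (d : ℚ)⌋₊ + 1 with hm₀
  obtain ⟨h, hh, h0, hreg⟩ := exists_linear_regular hs
  have hQ := isHilbertPolynomial_hyperplane_saturation hJ hq hh h0 hreg
  obtain ⟨hdH, hdG⟩ := hd N _ (isHomogeneousIdeal_hyperplane hJ hh).saturation
    (isSaturated_saturation _) hQ
  set A := J ⊔ Ideal.span {h}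
  have hAB : A ≤ saturation A := le_saturation A
  have hle : ∀ t, d ≤ t → (hilbertFunction J t : ℚ) ≤ q.eval (t : ℚ) := fun t ht =>
    hilbertFunction_le_of_isRegularityBound hd hJ hs hq ht
  have hstep : ∀ t, d ≤ t → q.eval ((t + 1 : ℕ) : ℚ) - hilbertFunction J (t + 1) =
      q.eval (t : ℚ) - hilbertFunction J t -
        ((hilbertFunction A (t + 1) : ℚ) - hilbertFunction (saturation A) (t + 1)) := by
    intro t ht
    have h1 := hdH (t + 1) (by omega)
    rw [eval_backwardDiff_succ] at h1
    have h3 : (hilbertFunction A (t + 1) : ℚ) + hilbertFunction J t =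
        hilbertFunction J (t + 1) := by
      exact_mod_cast hilbertFunction_sup_span_succ hJ hh h0 hreg t
    linarith
  -- From `d` on the saturation needs no new generators, so agreement in one degree passes to the
  -- next.
  have hpersist : ∀ t, d ≤ t → gradedPart A t = gradedPart (saturation A) t →
      gradedPart A (t + 1) = gradedPart (saturation A) (t + 1) := by
    intro t ht heq
    refine le_antisymm (gradedPart_mono hAB _) fun f hf => ⟨?_, hf.2⟩
    have := hdG t ht f hf
    rw [← heq] at this
    exact Ideal.span_le (I := A).2 (fun x (hx : x ∈ gradedPart A t) => hx.1) this
  have hdrop : ∀ m, gradedPart A (d + m) ≠ gradedPart (saturation A) (d + m) →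
      q.eval ((d + m : ℕ) : ℚ) - hilbertFunction J (d + m) ≤ q.eval (d : ℚ) - m := by
    intro m
    induction m with
    | zero => simp
    | succ m ih =>
      intro hne
      have ih' := ih fun heq => hne (hpersist (d + m) (by omega) heq)
      have hlt : hilbertFunction (saturation A) (d + m + 1) + 1 ≤
          hilbertFunction A (d + m + 1) :=
        lt_of_le_of_ne (hilbertFunction_anti hAB _) fun heq =>
          hne (gradedPart_eq_of_hilbertFunction_eq hAB heq.symm)
      have hlt' : (hilbertFunction (saturation A) (d + m + 1) : ℚ) + 1 ≤
          hilbertFunction A (d + m + 1) := by exact_mod_cast hlt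
      have := hstep (d + m) (by omega)
      rw [← add_assoc, this]
      push_cast at ih' ⊢
      linarith
  have heq₀ : gradedPart A (d + m₀) = gradedPart (saturation A) (d + m₀) := by
    by_contra hne
    have h1 := hdrop m₀ hne
    have h2 := hle (d + m₀) (by omega)
    have h3 : q.eval (d : ℚ) < m₀ := by
      rw [hm₀]
      exact_mod_cast Nat.lt_floor_add_one _
    linarith
  have heq : ∀ t, d + m₀ ≤ t → gradedPart A t = gradedPart (saturation A) t := by
    intro t ht
    induction t, ht using Nat.le_induction with
    | base => exact heq₀
    | succ t ht ih => exact hpersist t (by omega) ih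
  obtain ⟨T, hT⟩ := hq
  refine ⟨fun t ht => le_antisymm (hle t (by omega)) ?_, fun t ht f hf => ?_⟩
  -- The section now equals its saturation, so the defect is constant and, being eventually zero,
  -- vanishes.
  · refine sub_nonneg.1 (nonneg_of_antitone_of_eventually_eq_zero
      (F := fun t => hilbertFunction J t - q.eval (t : ℚ)) (d := d + m₀) (T := T) ?_ ?_ ht)
    · intro s hs
      have h1 := hstep s (by omega)
      rw [hilbertFunction_congr (heq (s + 1) (by omega)), sub_self] at h1
      linarith
    · intro s hs
      rw [hT s hs, sub_self]
  · refine mem_span_gradedPart_of_hyperplane hJ hh hreg hf ?_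
    have := hdG t (by omega) f (gradedPart_mono (le_sup_left.trans hAB) _ hf)
    rwa [← heq t ht] at this

/-- Uniform regularity of saturated ideals with a given Hilbert polynomial. -/
theorem exists_isRegularityBound (K : Type*) [Field K] [Infinite K] (q : Polynomial ℚ) :
    ∃ d, IsRegularityBound K q d := by
  induction q using Polynomial.degree_lt_wf.induction with
  | h q ih =>
    by_cases hq : q = 0
    · exact ⟨0, hq ▸ isRegularityBound_zero⟩
    · obtain ⟨d, hd⟩ := ih _ (degree_backwardDiff_lt hq)
      exact exists_isRegularityBound_of_backwardDiff hd

/-- Among the integer translates of `p`, the admissible ones are bounded below. -/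
theorem exists_le_of_isAdmissible_add_C (K : Type*) [Field K] [Infinite K] (p : Polynomial ℚ) :
    ∃ b : ℤ, ∀ u : ℤ, IsAdmissible K (p + Polynomial.C (u : ℚ)) → b ≤ u := by
  obtain ⟨d, hd⟩ := exists_isRegularityBound K (backwardDiff p)
  refine ⟨⌊-p.eval (d : ℚ)⌋, ?_⟩
  rintro u ⟨N, J, hJ, hs, hq⟩
  rw [← backwardDiff_add_C p u] at hd
  have h := hilbertFunction_le_of_isRegularityBound hd hJ hs hq le_rfl
  have h0 : (0 : ℚ) ≤ hilbertFunction J d := Nat.cast_nonneg _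
  rw [Polynomial.eval_add, Polynomial.eval_C] at h
  have : ((⌊-p.eval (d : ℚ)⌋ : ℤ) : ℚ) ≤ u := (Int.floor_le _).trans (by linarith)
  exact_mod_cast this

/-! ### Monomial and Borel ideals, and the colon by powers of `x_1`. -/

lemma IsMonomialIdeal.mem_iff {J : Ideal (MvPolynomial (Fin (n + 1)) K)} (hJ : IsMonomialIdeal J)
    {f : MvPolynomial (Fin (n + 1)) K} :
    f ∈ J ↔ ∀ α ∈ f.support, Term.toPoly K α ∈ J := by
  obtain ⟨A, rfl⟩ := hJ
  change f ∈ Ideal.span ((fun s => monomial s (1 : K)) '' A) ↔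
    ∀ α ∈ f.support, monomial α (1 : K) ∈ Ideal.span ((fun s => monomial s (1 : K)) '' A)
  simp_rw [mem_ideal_span_monomial_image]
  simp

lemma IsMonomialIdeal.isHomogeneousIdeal {J : Ideal (MvPolynomial (Fin (n + 1)) K)}
    (hJ : IsMonomialIdeal J) : IsHomogeneousIdeal J := by
  obtain ⟨A, rfl⟩ := hJ
  refine isHomogeneousIdeal_span ?_
  rintro _ ⟨α, -, rfl⟩
  exact ⟨α.degree, isHomogeneous_monomial 1 rfl⟩

lemma IsMonomialIdeal.X_mul_mem_iff {J : Ideal (MvPolynomial (Fin (n + 1)) K)}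
    (hJ : IsMonomialIdeal J) {f : MvPolynomial (Fin (n + 1)) K} {i : Fin (n + 1)} :
    X i * f ∈ J ↔ ∀ α ∈ f.support, Term.toPoly K (Finsupp.single i 1 + α) ∈ J := by
  rw [hJ.mem_iff, support_X_mul]
  simp

/-- One elementary move read backwards: the Borel condition allows raising the index of a variable.
-/
lemma IsBorelIdeal.toPoly_succ_mem {J : Ideal (MvPolynomial (Fin (n + 1)) K)}
    (hJ : IsBorelIdeal J) {α : Term n} {j : Fin n}
    (h : Term.toPoly K (Finsupp.single j.castSucc 1 + α) ∈ J) :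
    Term.toPoly K (Finsupp.single j.succ 1 + α) ∈ J := by
  refine ((hJ.2 (α.degree + 1)).2 _ ⟨?_, h⟩ _ ?_ (Relation.TransGen.single ⟨j, ?_, ?_⟩)).2
  · rw [map_add, Finsupp.degree_single, add_comm]
  · rw [map_add, Finsupp.degree_single, add_comm]
  · simp
  · rw [eMinus, add_tsub_cancel_left, add_comm]

lemma IsBorelIdeal.X_mul_mem {J : Ideal (MvPolynomial (Fin (n + 1)) K)}
    (hJ : IsBorelIdeal J) {f : MvPolynomial (Fin (n + 1)) K} {i j : Fin (n + 1)} (hij : i ≤ j)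
    (h : X i * f ∈ J) : X j * f ∈ J := by
  induction j using Fin.induction with
  | zero => rwa [← Fin.le_zero_iff.1 hij]
  | succ j ih =>
    rcases hij.eq_or_lt with rfl | hlt
    · exact h
    · rw [hJ.1.X_mul_mem_iff]
      intro α hα
      exact hJ.toPoly_succ_mem (hJ.1.X_mul_mem_iff.1 (ih (Fin.le_castSucc_iff.2 hlt)) α hα)

lemma IsBorelIdeal.X_pow_mul_mem {J : Ideal (MvPolynomial (Fin (n + 1)) K)}
    (hJ : IsBorelIdeal J) {i j : Fin (n + 1)} (hij : i ≤ j) (k : ℕ) :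
    ∀ {f : MvPolynomial (Fin (n + 1)) K}, X i ^ k * f ∈ J → X j ^ k * f ∈ J := by
  induction k with
  | zero => exact fun h => by simpa using h
  | succ k ih =>
    intro f h
    rw [pow_succ, mul_assoc]
    refine ih ?_
    rw [mul_left_comm]
    refine hJ.X_mul_mem hij ?_
    rwa [← mul_assoc, ← pow_succ']

/-- The variable `x_0` is regular modulo a saturated Borel ideal. -/
lemma IsBorelIdeal.mem_of_X_zero_mul_mem {J : Ideal (MvPolynomial (Fin (n + 1)) K)}
    (hJ : IsBorelIdeal J) (hs : IsSaturated J) {f : MvPolynomial (Fin (n + 1)) K}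
    (h : X 0 * f ∈ J) : f ∈ J :=
  hs f fun i => ⟨1, by simpa using hJ.X_mul_mem (Fin.zero_le i) h⟩

/-- The saturation `I : x_i^∞` with respect to one variable. -/
def colonVariable (I : Ideal (MvPolynomial (Fin (n + 1)) K)) (i : Fin (n + 1)) :
    Ideal (MvPolynomial (Fin (n + 1)) K) where
  carrier := {f | ∃ k : ℕ, X i ^ k * f ∈ I}
  add_mem' := by
    rintro f g ⟨k, hk⟩ ⟨l, hl⟩
    refine ⟨k + l, ?_⟩
    have : X i ^ (k + l) * (f + g) = X i ^ l * (X i ^ k * f) + X i ^ k * (X i ^ l * g) := by ring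
    rw [this]
    exact I.add_mem (I.mul_mem_left _ hk) (I.mul_mem_left _ hl)
  zero_mem' := ⟨0, by simp⟩
  smul_mem' := by
    rintro c f ⟨k, hk⟩
    refine ⟨k, ?_⟩
    rw [smul_eq_mul, mul_left_comm]
    exact I.mul_mem_left _ hk

lemma le_colonVariable (I : Ideal (MvPolynomial (Fin (n + 1)) K)) (i : Fin (n + 1)) :
    I ≤ colonVariable I i :=
  fun f hf => ⟨0, by simpa using hf⟩

/-- Testing the single variable `x_i` already suffices. -/
lemma isSaturated_colonVariable (I : Ideal (MvPolynomial (Fin (n + 1)) K)) (i : Fin (n + 1)) :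
    IsSaturated (colonVariable I i) := by
  intro f hf
  obtain ⟨k, l, hl⟩ := hf i
  exact ⟨l + k, by rwa [pow_add, mul_assoc]⟩

lemma IsHomogeneousIdeal.colonVariable {I : Ideal (MvPolynomial (Fin (n + 1)) K)}
    (hI : IsHomogeneousIdeal I) (i : Fin (n + 1)) : IsHomogeneousIdeal (colonVariable I i) := by
  rintro f ⟨k, hk⟩ t
  exact ⟨k, X_pow_mul_homogeneousComponent_mem hI hk t⟩

lemma exists_minGens_le {J : Ideal (MvPolynomial (Fin (n + 1)) K)} {α : Term n}
    (hα : Term.toPoly K α ∈ J) : ∃ γ ∈ minGens J, γ ≤ α := by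
  obtain ⟨γ, hle, hγ⟩ := exists_minimal_le_of_wellFoundedLT
    (fun β : Term n => Term.toPoly K β ∈ J) α hα
  exact ⟨γ, hγ, hle⟩

lemma toPoly_mem_of_le {J : Ideal (MvPolynomial (Fin (n + 1)) K)} {α β : Term n}
    (hαβ : α ≤ β) (hα : Term.toPoly K α ∈ J) : Term.toPoly K β ∈ J := by
  have : Term.toPoly K β = Term.toPoly K (β - α) * Term.toPoly K α := by
    simp only [Term.toPoly]
    rw [monomial_mul, mul_one, tsub_add_cancel_of_le hαβ]
  rw [this]
  exact J.mul_mem_left _ hα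

lemma setX0X1One_le (α : Term n) : setX0X1One α ≤ α := by
  intro i
  rw [setX0X1One, Finsupp.filter_apply]
  split_ifs <;> simp

lemma toPoly_eq_mul_setX0X1One (α : Term (n + 1)) :
    Term.toPoly K α = X 0 ^ α 0 * (X 1 ^ α 1 * Term.toPoly K (setX0X1One α)) := by
  simp only [Term.toPoly]
  rw [X_pow_eq_monomial, X_pow_eq_monomial, monomial_mul, monomial_mul, one_mul, one_mul]
  refine congrArg (fun β => monomial β (1 : K)) (Finsupp.ext fun i => ?_)
  refine Fin.cases ?_ (fun i => Fin.cases ?_ (fun i => ?_) i) i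
  · simp [setX0X1One]
  · simp [setX0X1One]
  · have h1 : (i.succ.succ : Fin (n + 2)) ≠ 1 := by
      simp [Fin.ext_iff]
    simp [setX0X1One, h1.symm]

/-- A Borel ideal modulo which `x_0` and `x_1` are regular is `x_1`-saturated. -/
lemma isX1Saturated_of_colonVariable_le {I : Ideal (MvPolynomial (Fin (n + 1 + 1)) K)}
    (hI : IsBorelIdeal I) (hs : IsSaturated I) (h1 : colonVariable I 1 ≤ I) :
    IsX1Saturated I := by
  refine le_antisymm (fun f hf => ?_) (Ideal.span_le.2 ?_)
  · have hmon : IsMonomialIdeal (x1Saturation I) := ⟨_, rfl⟩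
    rw [hmon.mem_iff]
    intro α hα
    obtain ⟨γ, hγ, hle⟩ := exists_minGens_le (hI.1.mem_iff.1 hf α hα)
    exact toPoly_mem_of_le ((setX0X1One_le γ).trans hle)
      (Ideal.subset_span ⟨_, ⟨γ, hγ, rfl⟩, rfl⟩)
  · rintro _ ⟨_, ⟨γ, hγ, rfl⟩, rfl⟩
    have hmem : Term.toPoly K γ ∈ I := hγ.1
    rw [toPoly_eq_mul_setX0X1One] at hmem
    have hpow : ∀ (k : ℕ) (f : MvPolynomial (Fin (n + 1 + 1)) K), X 0 ^ k * f ∈ I → f ∈ I := by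
      intro k
      induction k with
      | zero => exact fun f h => by simpa using h
      | succ k ih =>
        intro f h
        rw [pow_succ', mul_assoc] at h
        exact ih f (hI.mem_of_X_zero_mul_mem hs h)
    exact h1 ⟨γ 1, hpow _ _ hmem⟩

/-- The Hilbert functions of a saturated Borel ideal `I` and of `I : x_1^∞` differ by a constant
in large degrees. -/
lemma exists_hilbertFunction_colonVariable_add {I : Ideal (MvPolynomial (Fin (n + 1 + 1)) K)}
    (hI : IsBorelIdeal I) (hs : IsSaturated I) :
    ∃ c T : ℕ, ∀ t, T ≤ t → hilbertFunction (colonVariable I 1) t + c = hilbertFunction I t := by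
  set J := colonVariable I 1
  have hIhom := hI.1.isHomogeneousIdeal
  have hJhom : IsHomogeneousIdeal J := hIhom.colonVariable 1
  have hX : (X 0 : MvPolynomial (Fin (n + 1 + 1)) K).IsHomogeneous 1 := isHomogeneous_X K 0
  have hregI : ∀ f, X 0 * f ∈ I → f ∈ I := fun f => hI.mem_of_X_zero_mul_mem hs
  have hregJ : ∀ f, X 0 * f ∈ J → f ∈ J := by
    rintro f ⟨k, hk⟩
    rw [mul_left_comm] at hk
    exact ⟨k, hregI _ hk⟩
  have hle : I ⊔ Ideal.span {X 0} ≤ J ⊔ Ideal.span {X 0} :=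
    sup_le_sup_right (le_colonVariable I 1) _
  -- If `x_1^k f ∈ I`, the Borel property gives `x_i^k f ∈ I` for all `i ≥ 1`, while `x_0 f` lies in
  -- `(x_0)`. Hence both sections have the same saturation, and the two Hilbert functions eventually
  -- have the same increments.
  have hsat : J ⊔ Ideal.span {X 0} ≤ saturation (I ⊔ Ideal.span {X 0}) := by
    refine sup_le ?_ (le_sup_right.trans (le_saturation _))
    rintro f ⟨k, hk⟩ i
    refine Fin.cases ?_ (fun i => ?_) i
    · exact ⟨1, Ideal.mem_sup_right (by
        rw [pow_one]
        exact Ideal.mul_mem_right _ _ (Ideal.mem_span_singleton_self _))⟩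
    · exact ⟨k, Ideal.mem_sup_left (hI.X_pow_mul_mem (by simp [Fin.le_def]) k hk)⟩
  obtain ⟨T, hT⟩ := gradedPart_saturation_eventually_eq (isHomogeneousIdeal_hyperplane hIhom hX)
  have hsec : ∀ t, T ≤ t → hilbertFunction (I ⊔ Ideal.span {X 0}) t =
      hilbertFunction (J ⊔ Ideal.span {X 0}) t := fun t ht =>
    hilbertFunction_congr (le_antisymm (gradedPart_mono hle t)
      ((gradedPart_mono hsat t).trans (hT t ht).ge))
  have hanti := hilbertFunction_anti (le_colonVariable I 1) T
  change hilbertFunction J T ≤ _ at hanti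
  refine ⟨hilbertFunction I T - hilbertFunction J T, T, fun t ht => ?_⟩
  induction t, ht using Nat.le_induction with
  | base => omega
  | succ t ht ih =>
    have h1 := hilbertFunction_sup_span_succ hIhom hX (X_ne_zero 0) hregI t
    have h2 := hilbertFunction_sup_span_succ hJhom hX (X_ne_zero 0) hregJ t
    have h3 := hsec (t + 1) (by omega)
    omega

end BorelIdeals

/-! ### The minimal translate and `x_1`-saturation. -/

theorem corollary4p5 (K : Type*) [Field K] [IsAlgClosed K] [CharZero K]
    (n : ℕ) (hn : 1 ≤ n)
    (p : Polynomial ℚ) (hp : BorelIdeals.IsAdmissible K p) (hdeg : p.natDegree ≤ n) :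
    ∃ phat ∈ BorelIdeals.admissibleTranslates K p,
      (∀ q ∈ BorelIdeals.admissibleTranslates K p,
        ∃ c : ℤ, 0 ≤ c ∧ q = phat + Polynomial.C (c : ℚ)) ∧
      (∀ I : Ideal (MvPolynomial (Fin (n + 1)) K),
        BorelIdeals.IsBorelIdeal I → BorelIdeals.IsSaturated I →
        BorelIdeals.IsHilbertPolynomial I phat → BorelIdeals.IsX1Saturated I) := by
  have : Infinite K := IsAlgClosed.instInfinite
  obtain ⟨b, hb⟩ := BorelIdeals.exists_le_of_isAdmissible_add_C K p
  obtain ⟨u, hu, hmin⟩ := Int.exists_least_of_bdd ⟨b, hb⟩ ⟨0, by simpa using hp⟩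
  refine ⟨p + Polynomial.C (u : ℚ), ⟨hu, u, rfl⟩, ?_, ?_⟩
  · rintro _ ⟨hq, v, rfl⟩
    refine ⟨v - u, sub_nonneg.2 (hmin v hq), ?_⟩
    rw [add_assoc, ← Polynomial.C_add]
    push_cast
    rw [add_sub_cancel]
  · intro I hI hs hpoly
    -- With at least two variables, the index `1` really names `x_1`, distinct from `x_0`.
    obtain ⟨m, rfl⟩ : ∃ m, n = m + 1 := ⟨n - 1, by omega⟩
    obtain ⟨c, T, hc⟩ := BorelIdeals.exists_hilbertFunction_colonVariable_add hI hs
    have hJhom := hI.1.isHomogeneousIdeal.colonVariable 1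
    obtain ⟨t₀, ht₀⟩ := hpoly
    -- The ideal `I : x_1^∞` realises the translate by `u - c`, so minimality of `u` gives `c = 0`.
    have hadm : BorelIdeals.IsAdmissible K (p + Polynomial.C ((u - c : ℤ) : ℚ)) := by
      refine ⟨m + 1, _, hJhom, BorelIdeals.isSaturated_colonVariable I 1, t₀ + T, fun t ht => ?_⟩
      have h1 := ht₀ t (by omega)
      rw [← hc t (by omega)] at h1
      simp only [Polynomial.eval_add, Polynomial.eval_C] at h1 ⊢
      push_cast at h1 ⊢
      linarith
    have hc0 : c = 0 := by
      have := hmin _ hadm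
      omega
    refine BorelIdeals.isX1Saturated_of_colonVariable_le hI hs
      (BorelIdeals.eq_of_hilbertFunction_eventually_eq hs hJhom
        (BorelIdeals.le_colonVariable I 1) (T := T) fun t ht => ?_).ge
    rw [← hc t ht, hc0, add_zero]
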